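/- A *closed convex curve* in the plane is the boundary $C=\partial K$ of a compact convex set $K\subset\mathbb{R}^2$ with non-empty interior. Let $\mathcal{C}$ be the set of all closed convex curves, equipped with the Hausdorff metric. For $C\in\mathcal{C}$ and $z\in C$, a *tangent line* to $C$ at $z$ is a line through $z$ such that $C$ lies in one of the two closed half-planes it bounds. If the tangent line $T(z)$ to $C$ at $z$ is unique, let $N^+(z)$ be the closed half-line that starts at $z$, is orthogonal to $T(z)$, and lies on the same side of $T(z)$ as $C$. A point $u\in\mathbb{R}^2$ *sees an image of itself via* $z\in C$ if the tangent line to $C$ at $z$ is unique and $u\in N^+(z)$. **Theorem.** There is a comeagre set $\mathcal{G}\subset\mathcal{C}$ such that for every $C\in\mathcal{G}$ there is a comeagre set $U\subset\mathbb{R}^2$ such that for every $u\in U$ the set $$\{z\in C : u \text{ sees an image of itself via } z\}$$ has the cardinality of the continuum. -/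

import Mathlib

namespace MagicMirror

/-- The Euclidean plane. -/
abbrev Plane : Type := EuclideanSpace ℝ (Fin 2)

/-- A closed convex curve: the boundary of a compact convex set with non-empty interior. -/
def IsClosedConvexCurve (C : Set Plane) : Prop :=
  ∃ K : Set Plane, IsCompact K ∧ Convex ℝ K ∧ (interior K).Nonempty ∧ C = frontier K

/-- The space of all closed convex curves. The metric is the one inherited from
`NonemptyCompacts`, that is, the Hausdorff distance between the curves. -/
abbrev ConvexCurve : Type :=
  {C : TopologicalSpace.NonemptyCompacts Plane // IsClosedConvexCurve (C : Set Plane)}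

/-- `n` is the inner unit normal of a tangent (supporting) line to `C` at `z`: the line
`{x | ⟪n, x - z⟫ = 0}` passes through `z`, and `C` lies on the side of it into which `n` points.
As a closed convex curve lies on no line, each tangent line has exactly one such `n`. -/
def IsInnerNormal (C : Set Plane) (z n : Plane) : Prop :=
  ‖n‖ = 1 ∧ ∀ c ∈ C, 0 ≤ inner ℝ n (c - z)

/-- `u` sees an image of itself via `z`: the point `z` lies on `C`, the tangent line to `C` at `z`
is unique, and `u` lies on the half-line that starts at `z`, is orthogonal to the tangent line,
and is on the same side of it as `C`. -/
def SeesItselfVia (C : Set Plane) (u z : Plane) : Prop :=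
  z ∈ C ∧ ∃ n : Plane, IsInnerNormal C z n ∧ (∀ m : Plane, IsInnerNormal C z m → m = n) ∧
    ∃ t : ℝ, 0 ≤ t ∧ u = z + t • n

end MagicMirror

/-! Let `K` be the convex body bounded by `C`. A local maximum `z` of the distance from `u` on `K`
lies on `C`, and `u - z` is then an inner normal direction. Tangents of a typical `C` are unique
(`eventually_unique_normal`), so continuum many such critical points are wanted.

A peak is a ball in which this distance exceeds, with slack, its values near the bounding sphere.
Peaks survive small changes of `K` and `u` (`HasPeakIn.stable`), and each contains a critical point
(`HasPeakIn.exists_critical`). Two tips erected just beyond the maximum split a peak into two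
(`exists_splits`), so splitting is open and dense among peaks. With countably many balls and a dense
sequence of `u`, Baire category makes all peaks of a typical `C` split for these `u`, and then for
most `u`. A Cantor scheme makes the closed critical set uncountable, hence of size continuum. -/

namespace MagicMirror

open Set Metric Filter Topology TopologicalSpace

/-! ### Category, Cantor schemes and boundary crossing -/

section Topology

/-- If `G` lies in the closure of the open set `S`, then most points of `G` are in `S`. -/
theorem eventually_residual_imp {X : Type*} [TopologicalSpace X] {G S : Set X}
    (hS : IsOpen S) (h : G ⊆ closure S) : ∀ᶠ x in residual X, x ∈ G → x ∈ S := by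
  have hd : Dense (S ∪ (closure G)ᶜ) := by
    intro x
    rw [closure_union]
    by_cases hx : x ∈ closure S
    · exact Or.inl hx
    · refine Or.inr (subset_closure fun hxG => hx ?_)
      exact closure_minimal h isClosed_closure hxG
  filter_upwards [residual_of_dense_open (hS.union isClosed_closure.isOpen_compl) hd] with x hx hxG
  exact hx.resolve_right fun h' => h' (subset_closure hxG)

/-- A compact set that meets every member of a family of closed sets in which each member contains
two disjoint members is uncountable. -/
theorem not_countable_of_splitting {X ι : Type*} [TopologicalSpace X] {M : Set X}
    (hM : IsCompact M) (hMc : IsClosed M) {B : ι → Set X} (hB : ∀ i, IsClosed (B i))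
    {P : ι → Prop} (hP : ∀ i, P i → (M ∩ B i).Nonempty) (h0 : ∃ i, P i)
    (hs : ∀ i, P i → ∃ j k, P j ∧ P k ∧ B j ⊆ B i ∧ B k ⊆ B i ∧ Disjoint (B j) (B k)) :
    ¬ M.Countable := by
  intro hc
  obtain ⟨i₀, hi₀⟩ := h0
  obtain ⟨f, rfl⟩ := hc.exists_eq_range (hP i₀ hi₀).left
  -- Of two disjoint members at least one misses `f n`, so a nested chain can avoid the enumerated
  -- points one at a time; compactness then yields a point that was not enumerated.
  have step : ∀ (i : {i // P i}) (n : ℕ), ∃ j : {i // P i}, B j ⊆ B i ∧ f n ∉ B j := by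
    rintro ⟨i, hi⟩ n
    obtain ⟨j, k, hj, hk, hji, hki, hd⟩ := hs i hi
    by_cases hn : f n ∈ B j
    · exact ⟨⟨k, hk⟩, hki, fun h => disjoint_left.1 hd hn h⟩
    · exact ⟨⟨j, hj⟩, hji, hn⟩
  choose g hg hgn using step
  let s : ℕ → {i // P i} := fun n => Nat.rec ⟨i₀, hi₀⟩ (fun n b => g b n) n
  obtain ⟨y, hy⟩ := IsCompact.nonempty_iInter_of_sequence_nonempty_isCompact_isClosed
    (fun n => range f ∩ B (s n).1) (fun n => inter_subset_inter_right _ (hg (s n) n))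
    (fun n => hP (s n).1 (s n).2) (hM.inter_right (hB _)) (fun n => hMc.inter (hB _))
  rw [mem_iInter] at hy
  obtain ⟨n, rfl⟩ := (hy 0).1
  exact hgn (s n) n (hy (n + 1)).2

theorem exists_mem_segment_frontier {E : Type*} [NormedAddCommGroup E] [NormedSpace ℝ E]
    {S : Set E} {x y : E} (hx : x ∈ S) (hy : y ∉ S) : ∃ z ∈ segment ℝ x y, z ∈ frontier S := by
  by_contra! h
  have hpre : IsPreconnected (segment ℝ x y) := (convex_segment x y).isPreconnected
  have hsub : segment ℝ x y ⊆ interior S ∪ (closure S)ᶜ := by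
    intro z hz
    by_cases hzc : z ∈ closure S
    · by_cases hzi : z ∈ interior S
      · exact Or.inl hzi
      · exact absurd ⟨hzc, hzi⟩ (h z hz)
    · exact Or.inr hzc
  have hxi : x ∈ interior S := by
    rcases hsub (left_mem_segment ℝ x y) with h' | h'
    · exact h'
    · exact absurd (subset_closure hx) h'
  have hdis : Disjoint (interior S) (closure S)ᶜ :=
    disjoint_compl_right.mono_left (interior_subset.trans subset_closure)
  have := hpre.subset_left_of_subset_union isOpen_interior isClosed_closure.isOpen_compl hdis hsub
    ⟨x, left_mem_segment ℝ x y, hxi⟩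
  exact hy (interior_subset (this (right_mem_segment ℝ x y)))

end Topology

/-! ### Convex bodies and their boundaries -/

section ConvexBodies

variable {E : Type*} [NormedAddCommGroup E] [InnerProductSpace ℝ E]

theorem closedConvexHull_subset_thickening {A B : Set E} {δ : ℝ} (hδ : 0 ≤ δ) {η : ℝ} (hη : δ < η)
    (h : A ⊆ cthickening δ B) :
    closedConvexHull ℝ A ⊆ thickening η (closedConvexHull ℝ B) := by
  refine (closedConvexHull_min (t := cthickening δ (closedConvexHull ℝ B)) ?_ ?_ ?_).trans ?_
  · exact h.trans (cthickening_subset_of_subset _ subset_closedConvexHull)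
  · exact convex_closedConvexHull.cthickening δ
  · exact isClosed_cthickening
  · exact cthickening_subset_thickening' (hδ.trans_lt hη) hη _

/-- A compact convex set is the closed convex hull of its boundary. -/
theorem closedConvexHull_frontier [Nontrivial E] {K : Set E} (hK : IsCompact K)
    (hc : Convex ℝ K) : closedConvexHull ℝ (frontier K) = K := by
  refine (closedConvexHull_min hK.isClosed.frontier_subset hc hK.isClosed).antisymm ?_
  -- Krein–Milman: it suffices that extreme points are never interior.
  conv_lhs => rw [← closure_convexHull_extremePoints hK hc]
  refine closure_minimal (convexHull_min ?_ convex_closedConvexHull) isClosed_closedConvexHull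
  intro x hx
  refine subset_closedConvexHull ⟨subset_closure hx.1, fun hxi => ?_⟩
  exact disjoint_left.1 (disjoint_interior_extremePoints K) hxi hx

theorem exists_unit_outer_normal [CompleteSpace E] {K : Set E} (hc : Convex ℝ K)
    (hi : (interior K).Nonempty) {x : E} (hx : x ∉ interior K) :
    ∃ n : E, ‖n‖ = 1 ∧ ∀ y ∈ K, inner ℝ n y ≤ inner ℝ n x := by
  obtain ⟨f, hf⟩ := geometric_hahn_banach_open_point hc.interior isOpen_interior hx
  set v := (InnerProductSpace.toDual ℝ E).symm f with hv
  have hfv : ∀ y, inner ℝ v y = f y := fun y => by simp [hv]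
  have hle : ∀ y ∈ K, inner ℝ v y ≤ inner ℝ v x := by
    intro y hy
    have hcl : IsClosed {y : E | inner ℝ v y ≤ inner ℝ v x} :=
      isClosed_le (by fun_prop) (by fun_prop)
    refine closure_minimal (s := interior K) (fun a ha => ?_) hcl ?_
    · simp only [mem_ofPred_eq, hfv]
      exact (hf a ha).le
    · rw [hc.closure_interior_eq_closure_of_nonempty_interior hi]
      exact subset_closure hy
  have hv0 : v ≠ 0 := by
    rintro h0
    obtain ⟨a, ha⟩ := hi
    have := hf a ha
    simp [← hfv, h0] at this
  refine ⟨‖v‖⁻¹ • v, norm_smul_inv_norm (𝕜 := ℝ) hv0, fun y hy => ?_⟩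
  simp only [real_inner_smul_left]
  exact mul_le_mul_of_nonneg_left (hle y hy) (by positivity)

/-- If a convex body `L` contains the convex body `K` and is close to it, then so are the
boundaries. -/
theorem hausdorffDist_frontier_le [CompleteSpace E] {K L : Set E} (hK : IsCompact K)
    (hKc : Convex ℝ K) (hKi : (interior K).Nonempty) (hL : IsCompact L) (hKL : K ⊆ L) {δ : ℝ}
    (hδ : 0 < δ) (hLK : L ⊆ thickening δ K) : hausdorffDist (frontier K) (frontier L) ≤ δ := by
  refine hausdorffDist_le_of_mem_dist hδ.le ?_ ?_
  · intro x hx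
    obtain ⟨n, hn, hnK⟩ := exists_unit_outer_normal hKc hKi hx.2
    -- Along the outer normal `n`, the point `x + δ • n` is at distance at least `δ` from `K`, so
    -- the segment to it must cross the boundary of `L`.
    have hout : x + δ • n ∉ L := by
      intro h
      obtain ⟨y, hy, hd⟩ := mem_thickening_iff.1 (hLK h)
      have h1 := hnK y hy
      have h2 : inner ℝ n (x + δ • n - y) ≤ ‖n‖ * ‖x + δ • n - y‖ := real_inner_le_norm _ _
      rw [← dist_eq_norm, inner_sub_right, inner_add_right, real_inner_smul_right,
        real_inner_self_eq_norm_sq, hn] at h2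
      linarith
    obtain ⟨z, hz, hzL⟩ :=
      exists_mem_segment_frontier (hKL (hK.isClosed.frontier_subset hx)) hout
    refine ⟨z, hzL, ?_⟩
    obtain ⟨t, ht, rfl⟩ := (segment_eq_image' ℝ x (x + δ • n)) ▸ hz
    have : dist x (x + t • (x + δ • n - x)) = t * δ := by
      simp [dist_eq_norm, norm_smul, hn, abs_of_nonneg ht.1, abs_of_pos hδ]
    rw [this]
    nlinarith [ht.2]
  · intro x hx
    have hxL := hL.isClosed.frontier_subset hx
    by_cases hxK : x ∈ K
    · exact ⟨x, ⟨subset_closure hxK, fun h => hx.2 (interior_mono hKL h)⟩, by simpa using hδ.le⟩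
    · obtain ⟨y, hy, hd⟩ := mem_thickening_iff.1 (hLK hxL)
      obtain ⟨z, hz, hzK⟩ := exists_mem_segment_frontier hy hxK
      refine ⟨z, hzK, ?_⟩
      have := segment_subset_closedBall_right y x hz
      rw [mem_closedBall, dist_comm] at this
      rw [dist_comm y x] at this
      exact this.trans hd.le

end ConvexBodies

/-! ### Peaks and their stability -/

section RobustPeaks

variable {X : Type*} [PseudoMetricSpace X]

/-- The distance from `u`, as a function on `K`, is larger at some point of the ball with centre `c`
and radius `r` than near the boundary of this ball, by a positive amount. -/
def HasPeakIn (K : Set X) (u c : X) (r : ℝ) : Prop :=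
  ∃ ε > 0, ∃ ρ, ∃ z ∈ K, dist z c < r ∧ ρ < dist z u ∧ ∀ x ∈ K, |dist x c - r| ≤ ε → dist x u ≤ ρ

theorem HasPeakIn.stable {K : Set X} {u c : X} {r : ℝ} (h : HasPeakIn K u c r) :
    ∃ δ > 0, ∀ (L : Set X) (u' : X), K ⊆ thickening δ L → L ⊆ thickening δ K → dist u u' < δ →
      HasPeakIn L u' c r := by
  obtain ⟨ε, hε, ρ, z, hz, hzc, hzu, hK⟩ := h
  -- The level rises by `2 * δ` and the height drops by less than `2 * δ`, so a gap of `5 * δ`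
  -- suffices; half of the shell's width absorbs the move from `L` back to `K`.
  obtain ⟨δ, hδ, h1, h2, h3⟩ : ∃ δ > 0, δ ≤ ε / 2 ∧ δ ≤ (dist z u - ρ) / 5 ∧ δ ≤ r - dist z c := by
    refine ⟨min (ε / 2) (min ((dist z u - ρ) / 5) (r - dist z c)), ?_, min_le_left _ _,
      (min_le_right _ _).trans (min_le_left _ _), (min_le_right _ _).trans (min_le_right _ _)⟩
    have h2 : 0 < (dist z u - ρ) / 5 := by linarith
    have h3 : 0 < r - dist z c := by linarith
    positivity
  refine ⟨δ, hδ, fun L u' hKL hLK huu => ?_⟩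
  obtain ⟨z', hz', hd⟩ := mem_thickening_iff.1 (hKL hz)
  refine ⟨ε / 2, by linarith, ρ + 2 * δ, z', hz', ?_, ?_, ?_⟩
  · linarith [dist_triangle_left z' c z]
  · have := dist_triangle4 z z' u' u
    rw [dist_comm u' u] at this
    linarith
  · intro x hx hxr
    obtain ⟨y, hy, hxy⟩ := mem_thickening_iff.1 (hLK hx)
    have h4 : |dist y c - dist x c| ≤ dist y x := abs_dist_sub_le y x c
    have h5 := abs_sub_le (dist y c) (dist x c) r
    rw [dist_comm y x] at h4
    have := hK y hy (by linarith)
    linarith [dist_triangle4 x y u u']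

/-- A point of `K` in the ball at which the distance from `u` is largest. -/
theorem HasPeakIn.exists_max {K : Set X} (hK : IsCompact K) {u c : X} {r : ℝ}
    (h : HasPeakIn K u c r) :
    ∃ z ∈ K, dist z c < r ∧ ∀ x ∈ K, dist x c ≤ r → dist x u ≤ dist z u := by
  obtain ⟨ε, hε, ρ, z, hz, hzc, hzu, hr⟩ := h
  obtain ⟨w, hw, hmax⟩ := (hK.inter_right (isClosed_closedBall (x := c) (ε := r))).exists_isMaxOn
    ⟨z, hz, hzc.le⟩ (f := fun x => dist x u) (by fun_prop)
  refine ⟨w, hw.1, lt_of_le_of_ne hw.2 fun hwr => ?_, fun x hx hxc => hmax ⟨hx, hxc⟩⟩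
  have h1 := hr w hw.1 (by simp [hwr, hε.le])
  have h2 : dist z u ≤ dist w u := hmax ⟨hz, hzc.le⟩
  linarith

/-- The ball with index `b` in a countable family of balls. -/
def indexedBall [SeparableSpace X] [Nonempty X] (b : ℕ × ℚ) : Set X :=
  closedBall (denseSeq X b.1) b.2

/-- `HasPeakIn` for the balls of the countable family. -/
def Peak [SeparableSpace X] [Nonempty X] (K : Set X) (u : X) (b : ℕ × ℚ) : Prop :=
  HasPeakIn K u (denseSeq X b.1) b.2

/-- The ball contains two disjoint balls with peaks. -/
def Splits [SeparableSpace X] [Nonempty X] (K : Set X) (u : X) (b : ℕ × ℚ) : Prop :=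
  ∃ b₁ b₂, Peak K u b₁ ∧ Peak K u b₂ ∧ indexedBall (X := X) b₁ ⊆ indexedBall b ∧
    indexedBall (X := X) b₂ ⊆ indexedBall b ∧ Disjoint (indexedBall (X := X) b₁) (indexedBall b₂)

theorem Splits.stable [SeparableSpace X] [Nonempty X] {K : Set X} {u : X} {b : ℕ × ℚ} (h : Splits K u b) :
    ∃ δ > 0, ∀ (L : Set X) (u' : X), K ⊆ thickening δ L → L ⊆ thickening δ K → dist u u' < δ →
      Splits L u' b := by
  obtain ⟨b₁, b₂, h₁, h₂, hs⟩ := h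
  obtain ⟨δ₁, hδ₁, H₁⟩ := h₁.stable
  obtain ⟨δ₂, hδ₂, H₂⟩ := h₂.stable
  refine ⟨min δ₁ δ₂, by positivity, fun L u' h h' hu => ⟨b₁, b₂, ?_, ?_, hs⟩⟩
  · exact H₁ L u' (h.trans (thickening_mono (min_le_left _ _) _))
      (h'.trans (thickening_mono (min_le_left _ _) _)) (hu.trans_le (min_le_left _ _))
  · exact H₂ L u' (h.trans (thickening_mono (min_le_right _ _) _))
      (h'.trans (thickening_mono (min_le_right _ _) _)) (hu.trans_le (min_le_right _ _))

end RobustPeaks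

/-! ### Critical points in peaks, and peaks at the apex of a cone -/

section Peaks

variable {E : Type*} [NormedAddCommGroup E] [InnerProductSpace ℝ E]

/-- A step `t • (x - z)` changes the squared distance from `u` by `t² ‖x - z‖² - 2 t ⟪u - z, x -
z⟫`. This is nonpositive for one small `t > 0`, so no limit is needed. -/
theorem inner_nonneg_of_local_max {K : Set E} (hc : Convex ℝ K) {u z : E} (hz : z ∈ K) {η : ℝ}
    (hη : 0 < η) (h : ∀ x ∈ K, dist x z < η → dist x u ≤ dist z u) {x : E} (hx : x ∈ K) :
    0 ≤ inner ℝ (u - z) (x - z) := by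
  obtain ⟨t, ht, ht1, htη⟩ : ∃ t : ℝ, 0 < t ∧ t ≤ 1 ∧ t * ‖x - z‖ < η := by
    refine ⟨min 1 (η / (‖x - z‖ + 1)), by positivity, min_le_left _ _, ?_⟩
    calc _ ≤ η / (‖x - z‖ + 1) * ‖x - z‖ := by gcongr; exact min_le_right _ _
      _ < η / (‖x - z‖ + 1) * (‖x - z‖ + 1) := by gcongr; linarith
      _ = η := by field_simp
  have hy := h (z + t • (x - z)) (hc.add_smul_sub_mem hz hx ⟨ht.le, ht1⟩)
    (by simpa [dist_eq_norm, norm_smul, abs_of_pos ht] using htη)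
  have hsq := pow_le_pow_left₀ dist_nonneg hy 2
  have he : z + t • (x - z) - u = t • (x - z) - (u - z) := by abel
  rw [dist_eq_norm, dist_eq_norm, he, norm_sub_sq_real, real_inner_smul_left, real_inner_comm,
    norm_sub_rev z u] at hsq
  have : 0 ≤ t * inner ℝ (u - z) (x - z) := by nlinarith [sq_nonneg ‖t • (x - z)‖]
  exact nonneg_of_mul_nonneg_right this ht

/-- The points of `C` at which `u` lies on the inner normal of a supporting hyperplane. -/
def criticalSet (C : Set E) (u : E) : Set E := {z ∈ C | ∀ x ∈ C, 0 ≤ inner ℝ (u - z) (x - z)}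

/-- Limits of local maxima need not be local maxima, but the supporting condition passes to limits;
hence the Cantor scheme is run in this set. -/
theorem isClosed_criticalSet {C : Set E} (hC : IsClosed C) (u : E) :
    IsClosed (criticalSet C u) := by
  have : criticalSet C u = C ∩ ⋂ x ∈ C, {z | 0 ≤ inner ℝ (u - z) (x - z)} := by
    ext z
    simp [criticalSet]
  rw [this]
  exact hC.inter (isClosed_biInter fun x _ => isClosed_le (by fun_prop) (by fun_prop))

theorem ne_of_local_max {K : Set E} (hc : Convex ℝ K) (hn : K.Nontrivial) {u z : E} (hz : z ∈ K)
    {η : ℝ} (hη : 0 < η) (h : ∀ x ∈ K, dist x z < η → dist x u ≤ dist z u) : z ≠ u := by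
  rintro rfl
  obtain ⟨x, hx, hxz⟩ := hn.exists_ne z
  have hpos : 0 < ‖x - z‖ := norm_pos_iff.2 (sub_ne_zero.2 hxz)
  obtain ⟨t, ht, ht1, htη⟩ : ∃ t : ℝ, 0 < t ∧ t ≤ 1 ∧ t * ‖x - z‖ < η := by
    refine ⟨min 1 (η / (2 * ‖x - z‖)), by positivity, min_le_left _ _, ?_⟩
    calc _ ≤ η / (2 * ‖x - z‖) * ‖x - z‖ := by gcongr; exact min_le_right _ _
      _ = η / 2 := by field_simp
      _ < η := by linarith
  have hd : dist (z + t • (x - z)) z = t * ‖x - z‖ := by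
    simp [dist_eq_norm, norm_smul, abs_of_pos ht]
  have := h _ (hc.add_smul_sub_mem hz hx ⟨ht.le, ht1⟩) (by rwa [hd])
  rw [hd, dist_self] at this
  exact absurd this (not_le.2 (by positivity))

theorem HasPeakIn.exists_critical [Nontrivial E] {K : Set E} (hK : IsCompact K) (hc : Convex ℝ K)
    {u c : E} {r : ℝ} (h : HasPeakIn K u c r) :
    (criticalSet (frontier K) u ∩ closedBall c r).Nonempty := by
  obtain ⟨z, hz, hzr, hmax⟩ := h.exists_max hK
  have hloc : ∀ x ∈ K, dist x z < r - dist z c → dist x u ≤ dist z u := fun x hx hxz =>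
    hmax x hx (by linarith [dist_triangle x z c])
  have hpos : 0 < r - dist z c := by linarith
  have hin : ∀ x ∈ K, 0 ≤ inner ℝ (u - z) (x - z) := fun x hx =>
    inner_nonneg_of_local_max hc hz hpos hloc hx
  have hzi : z ∉ interior K := by
    intro hzi
    obtain ⟨η, hη, hball⟩ := Metric.mem_nhds_iff.1 (mem_interior_iff_mem_nhds.1 hzi)
    have hn : K.Nontrivial := by
      obtain ⟨y, hy⟩ := exists_ne (0 : E)
      have hy' : 0 < ‖y‖ := norm_pos_iff.2 hy
      refine ⟨z, hz, z + (η / (2 * ‖y‖)) • y, hball ?_, ?_⟩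
      · have : η / (2 * ‖y‖) * ‖y‖ = η / 2 := by field_simp
        simp only [mem_ball, dist_eq_norm, add_sub_cancel_left, norm_smul, Real.norm_eq_abs]
        rw [abs_of_pos (by positivity), this]
        linarith
      · intro h
        rw [left_eq_add, smul_eq_zero] at h
        exact h.elim (by positivity) hy
    have hzu := ne_of_local_max hc hn hz hpos hloc
    have hy' : 0 < ‖u - z‖ := norm_pos_iff.2 (sub_ne_zero.2 hzu.symm)
    -- From an interior point a short step away from `u` stays in `K` and violates `hin`.
    have hmem : z - (η / (2 * ‖u - z‖)) • (u - z) ∈ K := by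
      apply hball
      have : η / (2 * ‖u - z‖) * ‖u - z‖ = η / 2 := by field_simp
      rw [mem_ball, dist_eq_norm, sub_sub_cancel_left, norm_neg, norm_smul, Real.norm_eq_abs,
        abs_of_pos (by positivity), this]
      linarith
    have := hin _ hmem
    rw [sub_sub_cancel_left, inner_neg_right, real_inner_smul_right,
      real_inner_self_eq_norm_sq] at this
    have : 0 < η / (2 * ‖u - z‖) * ‖u - z‖ ^ 2 := by positivity
    linarith
  exact ⟨z, ⟨⟨subset_closure hz, hzi⟩, fun x hx => hin x (hK.isClosed.frontier_subset hx)⟩, hzr.le⟩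

/-- A point `p` of `K` such that `K` lies in a cone with apex `p` around the direction `u - p` is
the peak of arbitrarily small balls. -/
theorem exists_peak_of_cone [SeparableSpace E] {K : Set E} {p u : E} (hp : p ∈ K) {κ : ℝ}
    (hκ : 0 < κ) (hcone : ∀ x ∈ K, inner ℝ (x - p) (p - u) ≤ -κ * ‖x - p‖) {η : ℝ} (hη : 0 < η) :
    ∃ b, Peak K u b ∧ indexedBall (X := E) b ⊆ ball p η := by
  -- For `‖x - p‖ ≤ η ≤ κ` the cone's gain `2 * κ * ‖x - p‖` beats the quadratic term `‖x - p‖ ^ 2`.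
  wlog hηκ : η ≤ κ generalizing η
  · obtain ⟨b, hb, hb'⟩ := this (η := min η κ) (by positivity) (min_le_right _ _)
    exact ⟨b, hb, hb'.trans (ball_subset_ball (min_le_left _ _))⟩
  -- These fractions put `p` inside the ball and keep the shell of half-width `η / 16` at distance
  -- between `η / 16` and `η` from `p`.
  obtain ⟨i, hi⟩ := (denseRange_denseSeq E).exists_dist_lt p (show 0 < η / 8 by positivity)
  obtain ⟨q, hq1, hq2⟩ := exists_rat_btwn (show η / 4 < η / 2 by linarith)
  set c := denseSeq E i
  have hP : ∀ x ∈ K, |dist x c - q| ≤ η / 16 → dist x u ^ 2 ≤ dist p u ^ 2 - κ * (η / 16) := by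
    intro x hx hxq
    have hxq' := abs_le.1 hxq
    have h1 : η / 16 ≤ ‖x - p‖ := by
      rw [← dist_eq_norm]
      linarith [dist_triangle x p c]
    have h2 : ‖x - p‖ ≤ η := by
      rw [← dist_eq_norm]
      linarith [dist_triangle_right x p c]
    have h3 := hcone x hx
    have he : x - u = (x - p) + (p - u) := by abel
    rw [dist_eq_norm, dist_eq_norm, he, norm_add_sq_real]
    nlinarith
  have hlt : Real.sqrt (dist p u ^ 2 - κ * (η / 16)) < dist p u ∨ dist p u = 0 := by
    by_cases h0 : dist p u = 0
    · exact Or.inr h0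
    · left
      have : 0 < dist p u := lt_of_le_of_ne dist_nonneg (Ne.symm h0)
      rw [Real.sqrt_lt' this]
      have : 0 < κ * (η / 16) := by positivity
      linarith
  refine ⟨(i, q), ?_, fun x hx => ?_⟩
  · rcases hlt with hlt | h0
    · exact ⟨η / 16, by positivity, _, p, hp, by linarith, hlt,
        fun x hx hxq => Real.le_sqrt_of_sq_le (hP x hx hxq)⟩
    -- If `p = u`, no square root lies below the height `0`; but `hP` leaves the shell empty, so
    -- level `-1` works.
    · refine ⟨η / 16, by positivity, -1, p, hp, by linarith, by rw [h0]; norm_num,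
        fun x hx hxq => ?_⟩
      have := hP x hx hxq
      rw [h0] at this
      have : 0 < κ * (η / 16) := by positivity
      nlinarith [sq_nonneg (dist x u)]
  · have hx' : dist x c ≤ q := hx
    rw [mem_ball]
    linarith [dist_triangle_right x p c]

/-- Compactness makes the strict inequality uniform, and the cone condition is closed and convex, so
it passes to the hull. -/
theorem exists_cone {S : Set E} (hS : IsCompact S) {p u : E}
    (h : ∀ x ∈ S, inner ℝ (x - p) (p - u) < 0) :
    ∃ κ > 0, ∀ x ∈ closedConvexHull ℝ (insert p S),
      inner ℝ (x - p) (p - u) ≤ -κ * ‖x - p‖ := by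
  obtain ⟨κ, hκ, hS'⟩ : ∃ κ > 0, ∀ x ∈ S, inner ℝ (x - p) (p - u) ≤ -κ * ‖x - p‖ := by
    rcases S.eq_empty_or_nonempty with rfl | hne
    · exact ⟨1, one_pos, by simp⟩
    obtain ⟨w, hw, hmax⟩ := hS.exists_isMaxOn hne (f := fun x => inner ℝ (x - p) (p - u))
      (by fun_prop)
    obtain ⟨R, hR⟩ := hS.isBounded.subset_closedBall p
    set m : ℝ := -inner ℝ (w - p) (p - u) with hm
    have hm0 : 0 < m := by have := h w hw; linarith
    have hR0 : 0 ≤ R := dist_nonneg.trans (mem_closedBall.1 (hR hw))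
    refine ⟨m / (R + 1), by positivity, fun x hx => ?_⟩
    have h1 : inner ℝ (x - p) (p - u) ≤ -m := by
      rw [hm, neg_neg]
      exact hmax hx
    have h2 : ‖x - p‖ ≤ R := by
      rw [← dist_eq_norm]
      exact hR hx
    have h3 : m / (R + 1) * ‖x - p‖ ≤ m := by
      rw [div_mul_eq_mul_div, div_le_iff₀ (by positivity)]
      nlinarith
    linarith
  refine ⟨κ, hκ, fun x hx => ?_⟩
  have hconv : ConvexOn ℝ univ fun x : E => inner ℝ (x - p) (p - u) + κ * ‖x - p‖ := by
    refine ⟨convex_univ, fun x _ y _ a b ha hb hab => ?_⟩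
    have he : a • x + b • y - p = a • (x - p) + b • (y - p) := by
      rw [smul_sub, smul_sub, sub_add_sub_comm, ← add_smul, hab, one_smul]
    have hn : ‖a • (x - p) + b • (y - p)‖ ≤ a * ‖x - p‖ + b * ‖y - p‖ := by
      refine (norm_add_le _ _).trans ?_
      rw [norm_smul, norm_smul, Real.norm_of_nonneg ha, Real.norm_of_nonneg hb]
    simp only [he, inner_add_left, real_inner_smul_left, smul_eq_mul]
    nlinarith
  have hsub : closedConvexHull ℝ (insert p S) ⊆
      {x | inner ℝ (x - p) (p - u) + κ * ‖x - p‖ ≤ 0} := by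
    refine closedConvexHull_min ?_ (by simpa using hconv.convex_le 0)
      (isClosed_le (by fun_prop) (by fun_prop))
    rintro x (rfl | hx)
    · simp
    · have := hS' x hx
      simp only [mem_ofPred_eq]
      linarith
  have := hsub hx
  simp only [mem_ofPred_eq] at this
  linarith

end Peaks

/-! ### Splitting a peak -/

section Perturbation

theorem exists_orthogonal (v : Plane) : ∃ w : Plane, ‖w‖ = ‖v‖ ∧ inner ℝ v w = 0 := by
  refine ⟨!₂[-v 1, v 0], ?_, ?_⟩
  · simp [EuclideanSpace.norm_eq, Fin.sum_univ_two, add_comm]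
  · simp [PiLp.inner_apply, Fin.sum_univ_two]
    ring

/-- A peak of a compact convex set can be split in two by an arbitrarily small enlargement. -/
theorem exists_splits {K : Set Plane} (hK : IsCompact K) (hc : Convex ℝ K) (hn : K.Nontrivial)
    {u : Plane} {b : ℕ × ℚ} (h : Peak K u b) {η : ℝ} (hη : 0 < η) :
    ∃ L, IsCompact L ∧ Convex ℝ L ∧ K ⊆ L ∧ L ⊆ thickening η K ∧ Splits L u b := by
  obtain ⟨z, hz, hzr, hmax⟩ := h.exists_max hK
  set c := denseSeq Plane b.1
  have hloc : ∀ x ∈ K, dist x z < b.2 - dist z c → dist x u ≤ dist z u := fun x hx hxz =>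
    hmax x hx (by linarith [dist_triangle x z c])
  have hpos : 0 < b.2 - dist z c := by linarith
  have hin : ∀ x ∈ K, 0 ≤ inner ℝ (u - z) (x - z) := fun x hx =>
    inner_nonneg_of_local_max hc hz hpos hloc hx
  have hzu := ne_of_local_max hc hn hz hpos hloc
  set v := z - u with hv
  have hv0 : 0 < ‖v‖ := norm_pos_iff.2 (sub_ne_zero.2 hzu)
  have hvK : ∀ x ∈ K, inner ℝ (x - u) v ≤ ‖v‖ ^ 2 := by
    intro x hx
    have h1 := hin x hx
    have h2 : u - z = -v := by rw [hv]; abel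
    have h3 : x - u = (x - z) + v := by rw [hv]; abel
    rw [h2, inner_neg_left, real_inner_comm] at h1
    rw [h3, inner_add_left, real_inner_self_eq_norm_sq]
    linarith
  obtain ⟨w, hw, hvw⟩ := exists_orthogonal v
  obtain ⟨R, hR⟩ := hK.isBounded.subset_closedBall u
  have hRz : ‖v‖ ≤ R := by
    rw [hv, ← dist_eq_norm]
    exact hR hz
  -- `μ` keeps the new tips close to `K` and, with small balls around them, inside the ball `b`.
  set μ := min (η / 2) (b.2 - dist z c) with hμ
  have hμ0 : 0 < μ := by positivity
  set s := μ / (4 * ‖v‖) with hs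
  have hs0 : 0 < s := by positivity
  have hsv : s * ‖v‖ = μ / 4 := by rw [hs]; field_simp
  set δ := s * ‖v‖ / (2 * R) with hδ
  have hR0 : 0 < R := hv0.trans_le hRz
  have hδ0 : 0 < δ := by positivity
  have hδR : δ * R = s * ‖v‖ / 2 := by rw [hδ]; field_simp
  have hδv : δ * ‖v‖ ≤ μ / 4 := by
    have : δ * ‖v‖ ≤ δ * R := by gcongr
    linarith
  -- The tips `a 1` and `a (-1)` lie beyond `z` as seen from `u`, shifted sideways. The choice `δ *
  -- R = s * ‖v‖ / 2` makes the shift too small to undo the forward gain, so `K` stays strictly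
  -- behind each tip.
  let a : ℝ → Plane := fun σ => u + ((1 + s) • v + (σ * δ) • w)
  have hau : ∀ σ, a σ - u = (1 + s) • v + (σ * δ) • w := fun σ => add_sub_cancel_left _ _
  have hnorm : ∀ σ : ℝ, σ ^ 2 = 1 → ‖a σ - u‖ ^ 2 = (1 + s) ^ 2 * ‖v‖ ^ 2 + δ ^ 2 * ‖v‖ ^ 2 := by
    intro σ hσ
    rw [hau, norm_add_sq_real, real_inner_smul_left, real_inner_smul_right, hvw, norm_smul,
      norm_smul, mul_pow, mul_pow, hw, Real.norm_eq_abs, Real.norm_eq_abs, sq_abs, sq_abs, mul_pow,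
      hσ]
    ring
  have haz : ∀ σ : ℝ, |σ| = 1 → dist (a σ) z ≤ μ / 2 := by
    intro σ hσ
    have h1 : a σ - z = s • v + (σ * δ) • w := by
      have : a σ - z = (a σ - u) - v := by rw [hv]; abel
      rw [this, hau, add_smul, one_smul]
      abel
    rw [dist_eq_norm, h1]
    refine (norm_add_le _ _).trans ?_
    rw [norm_smul, norm_smul, hw, Real.norm_eq_abs, Real.norm_eq_abs, abs_mul, hσ,
      abs_of_pos hs0, abs_of_pos hδ0]
    linarith
  have haK : ∀ σ : ℝ, |σ| = 1 → ∀ x ∈ K, inner ℝ (x - a σ) (a σ - u) < 0 := by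
    intro σ hσ x hx
    have h1 : x - a σ = (x - u) - (a σ - u) := by abel
    have h2 : inner ℝ (x - u) w * (σ * δ) ≤ R * ‖v‖ * δ := by
      refine (le_abs_self _).trans ?_
      rw [abs_mul, abs_mul, hσ, one_mul, abs_of_pos hδ0]
      gcongr
      refine (abs_real_inner_le_norm _ _).trans ?_
      rw [hw, ← dist_eq_norm]
      gcongr
      exact hR hx
    have h3 := hvK x hx
    rw [h1, inner_sub_left, real_inner_self_eq_norm_sq, hnorm σ (by rw [← sq_abs, hσ, one_pow]),
      hau, inner_add_right, real_inner_smul_right, real_inner_smul_right]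
    have h4 : (1 + s) * inner ℝ (x - u) v ≤ (1 + s) * ‖v‖ ^ 2 := by gcongr
    have h5 : 0 < δ ^ 2 * ‖v‖ ^ 2 := by positivity
    have h6 : R * ‖v‖ * δ = s * ‖v‖ ^ 2 / 2 := by linear_combination ‖v‖ * hδR
    have h7 : 0 < s * ‖v‖ ^ 2 := by positivity
    nlinarith [mul_pos hs0 h7]
  -- The tips are equidistant from `u`, so each is strictly behind the perpendicular at the other.
  have haa : ∀ σ : ℝ, |σ| = 1 → inner ℝ (a (-σ) - a σ) (a σ - u) < 0 := by
    intro σ hσ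
    have h1 : a (-σ) - a σ = (-2 * (σ * δ)) • w := by
      have : a (-σ) - a σ = (a (-σ) - u) - (a σ - u) := by abel
      rw [this, hau, hau]
      module
    rw [h1, hau, real_inner_smul_left, inner_add_right, real_inner_smul_right,
      real_inner_smul_right, real_inner_comm, hvw, real_inner_self_eq_norm_sq, hw]
    have hσ2 : σ ^ 2 = 1 := by rw [← sq_abs, hσ, one_pow]
    have : 0 < δ ^ 2 * ‖v‖ ^ 2 := by positivity
    have he : -2 * (σ * δ) * ((1 + s) * 0 + σ * δ * ‖v‖ ^ 2) = -2 * (δ ^ 2 * ‖v‖ ^ 2) := by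
      linear_combination (-2 * δ ^ 2 * ‖v‖ ^ 2) * hσ2
    linarith
  set L := closedConvexHull ℝ ({a 1, a (-1)} ∪ K) with hL
  have hKL : K ⊆ L := subset_union_right.trans subset_closedConvexHull
  have hLsub : L ⊆ cthickening (η / 2) K := by
    refine closedConvexHull_min ?_ (hc.cthickening _) isClosed_cthickening
    rintro x (hx | hx)
    · refine mem_cthickening_of_dist_le x z _ _ hz ?_
      have : dist x z ≤ μ / 2 := by
        rcases hx with rfl | rfl
        · exact haz 1 (by simp)
        · exact haz (-1) (by simp)
      linarith [min_le_left (η / 2) (b.2 - dist z c)]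
    · exact self_subset_cthickening K hx
  have hpeak : ∀ σ : ℝ, |σ| = 1 → L = closedConvexHull ℝ (insert (a σ) (insert (a (-σ)) K)) →
      ∀ θ > 0, ∃ b', Peak L u b' ∧ indexedBall (X := Plane) b' ⊆ ball (a σ) θ := by
    intro σ hσ hLσ θ hθ
    obtain ⟨κ, hκ, hcone⟩ := exists_cone (S := insert (a (-σ)) K) (p := a σ) (u := u)
      (hK.insert _) (by
        rintro x (rfl | hx)
        · exact haa σ hσ
        · exact haK σ hσ x hx)
    rw [← hLσ] at hcone
    refine exists_peak_of_cone ?_ hκ hcone hθ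
    rw [hLσ]
    exact subset_closedConvexHull (mem_insert _ _)
  have hne : a 1 ≠ a (-1) := by
    intro he
    have := haa 1 (by simp)
    rw [he, sub_self, inner_zero_left] at this
    exact lt_irrefl _ this
  set θ := min (μ / 2) (dist (a 1) (a (-1)) / 2) with hθ
  have hθ0 : 0 < θ := by
    have := dist_pos.2 hne
    positivity
  obtain ⟨b₁, hb₁, hs₁⟩ := hpeak 1 (by simp) (by rw [hL, insert_union, singleton_union]) θ hθ0
  obtain ⟨b₂, hb₂, hs₂⟩ := hpeak (-1) (by simp)
    (by rw [hL, neg_neg, insert_union, singleton_union, insert_comm]) θ hθ0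
  have hball : ∀ σ : ℝ, |σ| = 1 → ball (a σ) θ ⊆ indexedBall b := by
    intro σ hσ
    refine (ball_subset_closedBall).trans (closedBall_subset_closedBall' ?_)
    have h1 := haz σ hσ
    have h2 := dist_triangle (a σ) z c
    have h3 : θ ≤ μ / 2 := min_le_left _ _
    have h4 : μ ≤ b.2 - dist z c := min_le_right _ _
    show θ + dist (a σ) c ≤ b.2
    linarith
  refine ⟨L, (hK.cthickening).of_isClosed_subset isClosed_closedConvexHull hLsub,
    convex_closedConvexHull, hKL,
    hLsub.trans (cthickening_subset_thickening' hη (by linarith) _),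
    b₁, b₂, hb₁, hb₂, hs₁.trans (hball 1 (by simp)), hs₂.trans (hball (-1) (by simp)), ?_⟩
  refine (ball_disjoint_ball ?_).mono hs₁ hs₂
  linarith [min_le_right (μ / 2) (dist (a 1) (a (-1)) / 2)]

end Perturbation

/-! ### Nearly unique normals -/

section Normals

theorem IsInnerNormal.inner_nonneg_of_mem_hull {C : Set Plane} {z n : Plane}
    (h : IsInnerNormal C z n) {x : Plane} (hx : x ∈ closedConvexHull ℝ C) :
    0 ≤ inner ℝ n (x - z) := by
  have hsub : closedConvexHull ℝ C ⊆ {x | inner ℝ n z ≤ inner ℝ n x} := by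
    refine closedConvexHull_min (fun c hc => ?_)
      (convex_halfSpace_ge (innerSL ℝ n).isLinear _)
      (isClosed_le (by fun_prop) (by fun_prop))
    have := h.2 c hc
    rw [inner_sub_right] at this
    simp only [mem_ofPred_eq]
    linarith
  have := hsub hx
  simp only [mem_ofPred_eq] at this
  rw [inner_sub_right]
  linarith

/-- If `C` almost surrounds a ball of radius `ε` and `z` is close to this ball, then each inner
normal of `C` at `z` points roughly to the centre of the ball. -/
theorem IsInnerNormal.le_inner_center {C : Set Plane} {z n y : Plane} {ε δ : ℝ} (hε : 0 ≤ ε)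
    (h : IsInnerNormal C z n) (hy : closedBall y ε ⊆ thickening δ (closedConvexHull ℝ C)) :
    ε - δ ≤ inner ℝ n (y - z) := by
  have hmem : y - ε • n ∈ closedBall y ε := by
    simp [norm_smul, h.1, abs_of_nonneg hε]
  obtain ⟨w, hw, hd⟩ := mem_thickening_iff.1 (hy hmem)
  have h1 := h.inner_nonneg_of_mem_hull hw
  have h2 : inner ℝ n (w - (y - ε • n)) ≤ ‖n‖ * ‖w - (y - ε • n)‖ := real_inner_le_norm _ _
  rw [← dist_eq_norm, dist_comm, h.1] at h2
  have h3 : y - z = (w - z) - (w - (y - ε • n)) + ε • n := by abel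
  rw [h3, inner_add_right, inner_sub_right, real_inner_smul_right, real_inner_self_eq_norm_sq, h.1]
  linarith

/-- Both normals have a large component towards `y`, so their sum is long; as `δ / ε` tends to `0`
the bound forces length `2`, that is, `n = m`. -/
theorem IsInnerNormal.norm_add_ge {C : Set Plane} {z n m y : Plane} {ε δ : ℝ} (hε : 0 ≤ ε)
    (hn : IsInnerNormal C z n) (hm : IsInnerNormal C z m)
    (hy : closedBall y ε ⊆ thickening δ (closedConvexHull ℝ C)) (hz : dist y z ≤ ε + δ) :
    2 * (ε - δ) ≤ ‖n + m‖ * (ε + δ) := by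
  have h1 := hn.le_inner_center hε hy
  have h2 := hm.le_inner_center hε hy
  have h3 : inner ℝ (n + m) (y - z) ≤ ‖n + m‖ * ‖y - z‖ := real_inner_le_norm _ _
  rw [inner_add_left, ← dist_eq_norm] at h3
  have h4 : ‖n + m‖ * dist y z ≤ ‖n + m‖ * (ε + δ) := by gcongr
  linarith

theorem eq_of_two_le_norm_add {n m : Plane} (hn : ‖n‖ = 1) (hm : ‖m‖ = 1) (h : 2 ≤ ‖n + m‖) :
    n = m := by
  have := parallelogram_law_with_norm ℝ n m
  rw [hn, hm] at this
  have h0 : ‖n - m‖ = 0 := by nlinarith [norm_nonneg (n - m)]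
  exact sub_eq_zero.1 (norm_eq_zero.1 h0)

end Normals

/-! ### Generic properties of curves -/

section Curves

/-- The convex body bounded by a closed convex curve. -/
def body (C : ConvexCurve) : Set Plane := closedConvexHull ℝ (C.1 : Set Plane)

theorem body_spec (C : ConvexCurve) : IsCompact (body C) ∧ Convex ℝ (body C) ∧
    (interior (body C)).Nonempty ∧ (C.1 : Set Plane) = frontier (body C) := by
  obtain ⟨K, hK, hc, hi, hCK⟩ := C.2
  have : body C = K := by rw [body, hCK, closedConvexHull_frontier hK hc]
  rw [this]
  exact ⟨hK, hc, hi, hCK⟩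

theorem nontrivial_body (C : ConvexCurve) : (body C).Nontrivial := by
  by_contra h
  rw [not_nontrivial_iff] at h
  obtain ⟨x, hx⟩ := (body_spec C).2.2.1
  have hsub : interior (body C) = {x} :=
    (h.anti interior_subset).eq_singleton_of_mem hx
  exact not_isOpen_singleton x (hsub ▸ isOpen_interior)

theorem hausdorffEDist_ne_top (C D : NonemptyCompacts Plane) :
    hausdorffEDist (C : Set Plane) D ≠ ⊤ :=
  hausdorffEDist_ne_top_of_nonempty_of_bounded C.nonempty D.nonempty C.isCompact.isBounded
    D.isCompact.isBounded

theorem body_subset_thickening {C D : ConvexCurve} {δ : ℝ} (h : dist C D < δ) :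
    body C ⊆ thickening δ (body D) := by
  obtain ⟨δ', h1, h2⟩ := exists_between h
  refine closedConvexHull_subset_thickening (dist_nonneg.trans h1.le) h2 fun x hx => ?_
  obtain ⟨y, hy, hd⟩ := exists_dist_lt_of_hausdorffDist_lt hx
    (show hausdorffDist (C.1 : Set Plane) D.1 < δ' from h1) (hausdorffEDist_ne_top _ _)
  exact mem_cthickening_of_dist_le x y _ _ hy hd.le

/-- A small enlargement of the body bounded by a closed convex curve is bounded by a nearby closed
convex curve. -/
theorem exists_curve_near (C : ConvexCurve) {L : Set Plane} (hL : IsCompact L) (hc : Convex ℝ L)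
    (hCL : body C ⊆ L) {δ : ℝ} (hδ : 0 < δ) (hLC : L ⊆ thickening δ (body C)) :
    ∃ D : ConvexCurve, body D = L ∧ dist C D ≤ δ := by
  obtain ⟨hK, hKc, hKi, hCK⟩ := body_spec C
  have hne : (frontier L).Nonempty := by
    rw [nonempty_frontier_iff]
    exact ⟨hKi.mono (interior_subset.trans hCL), fun h => noncompact_univ Plane (h ▸ hL)⟩
  let D : ConvexCurve := ⟨⟨⟨frontier L, hL.of_isClosed_subset isClosed_frontier
    hL.isClosed.frontier_subset⟩, hne⟩, L, hL, hc, hKi.mono (interior_mono hCL), rfl⟩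
  refine ⟨D, closedConvexHull_frontier hL hc, ?_⟩
  show hausdorffDist (C.1 : Set Plane) (frontier L) ≤ δ
  rw [hCK]
  exact hausdorffDist_frontier_le hK hKc hKi hL hCL hδ hLC

/-- Most closed convex curves have a unique tangent line at each point. -/
theorem eventually_unique_normal : ∀ᶠ C : ConvexCurve in residual ConvexCurve,
    ∀ z ∈ (C.1 : Set Plane), ∀ n m, IsInnerNormal (C.1 : Set Plane) z n →
      IsInnerNormal (C.1 : Set Plane) z m → n = m := by
  let A : ℝ → Set ConvexCurve := fun s => {C | ∀ z ∈ (C.1 : Set Plane), ∀ n m,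
    IsInnerNormal (C.1 : Set Plane) z n → IsInnerNormal (C.1 : Set Plane) z m →
      2 * (1 - s) ≤ ‖n + m‖ * (1 + s)}
  have hA : ∀ s > 0, ∀ᶠ C : ConvexCurve in residual ConvexCurve, C ∈ A s := by
    intro s hs
    have hdense : (univ : Set ConvexCurve) ⊆ closure (interior (A s)) := by
      rintro C -
      rw [Metric.mem_closure_iff]
      intro η hη
      obtain ⟨hK, hKc, hKi, hCK⟩ := body_spec C
      set ε := η / 4 with hε
      have hε0 : 0 < ε := by positivity
      -- Thickening rounds off corners: each point of the new body lies in a disc of radius `ε`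
      -- contained in it, and curves within `s * ε` of `D` still nearly surround that disc.
      obtain ⟨D, hD, hCD⟩ := exists_curve_near C (L := cthickening ε (body C)) hK.cthickening
        (hKc.cthickening ε) (self_subset_cthickening _) (δ := η / 2) (by positivity)
        (cthickening_subset_thickening' (by positivity) (by linarith) _)
      refine ⟨D, ?_, by linarith⟩
      rw [mem_interior_iff_mem_nhds, Metric.mem_nhds_iff]
      have hδ : 0 < s * ε := by positivity
      refine ⟨s * ε, hδ, fun C' hC' z hz n m hn hm => ?_⟩
      rw [mem_ball, dist_comm] at hC'
      obtain ⟨x, hx, hxz⟩ := exists_dist_lt_of_hausdorffDist_lt' hz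
        (show hausdorffDist (D.1 : Set Plane) C'.1 < s * ε from hC') (hausdorffEDist_ne_top _ _)
      have hxD : x ∈ cthickening ε (body C) := hD ▸ subset_closedConvexHull hx
      rw [hK.cthickening_eq_biUnion_closedBall hε0.le] at hxD
      simp only [mem_iUnion] at hxD
      obtain ⟨y, hy, hxy⟩ := hxD
      have hball : closedBall y ε ⊆ thickening (s * ε) (closedConvexHull ℝ (C'.1 : Set Plane)) := by
        refine (closedBall_subset_cthickening hy ε).trans ?_
        rw [← hD]
        exact body_subset_thickening hC'
      have := hn.norm_add_ge hε0.le hm hball (by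
        have := dist_triangle_left y z x
        have := mem_closedBall.1 hxy
        linarith)
      refine le_of_mul_le_mul_right ?_ hε0
      linarith
    filter_upwards [eventually_residual_imp isOpen_interior hdense] with C hC
    exact interior_subset (hC (mem_univ C))
  have hall : ∀ᶠ C : ConvexCurve in residual ConvexCurve, ∀ k : ℕ, C ∈ A (1 / (k + 1)) :=
    eventually_countable_forall.2 fun k => hA _ (by positivity)
  filter_upwards [hall] with C hC z hz n m hn hm
  refine eq_of_two_le_norm_add hn.1 hm.1 ?_
  by_contra! hlt
  have hN := norm_nonneg (n + m)
  obtain ⟨k, hk⟩ := exists_nat_one_div_lt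
    (show 0 < (2 - ‖n + m‖) / (2 + ‖n + m‖) by apply div_pos <;> linarith)
  have := hC k z hz n m hn hm
  rw [lt_div_iff₀ (by positivity)] at hk
  linarith

/-- For most closed convex curves, splitting peaks are dense among the peaks. -/
theorem eventually_peak_imp_splits : ∀ᶠ C : ConvexCurve in residual ConvexCurve,
    ∀ (b : ℕ × ℚ) (k : ℕ), Peak (body C) (denseSeq Plane k) b →
      Splits (body C) (denseSeq Plane k) b := by
  refine eventually_countable_forall.2 fun b => eventually_countable_forall.2 fun k => ?_
  -- Only countably many `u` can be treated at once; stability later extends the result to most `u`.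
  set u := denseSeq Plane k
  refine eventually_residual_imp (G := {C | Peak (body C) u b}) (S := {C | Splits (body C) u b})
    (Metric.isOpen_iff.2 fun C hC => ?_) fun C hC => Metric.mem_closure_iff.2 fun η hη => ?_
  · obtain ⟨δ, hδ, H⟩ := Splits.stable hC
    refine ⟨δ, hδ, fun D hD => H _ _ (body_subset_thickening ?_) (body_subset_thickening hD)
      (by simpa using hδ)⟩
    rwa [dist_comm]
  · obtain ⟨hK, hKc, -, -⟩ := body_spec C
    obtain ⟨L, hL, hLc, hKL, hLK, hs⟩ :=
      exists_splits hK hKc (nontrivial_body C) hC (half_pos hη)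
    obtain ⟨D, rfl, hCD⟩ := exists_curve_near C hL hLc hKL (half_pos hη) hLK
    exact ⟨D, hs, by linarith⟩

/-- The ball is so large that its shell misses `K`; this starts the Cantor scheme. -/
theorem exists_peak {K : Set Plane} (hK : IsCompact K) (hn : K.Nontrivial) (u : Plane) :
    ∃ b, Peak K u b := by
  set c := denseSeq Plane 0
  obtain ⟨R, hR⟩ := hK.isBounded.subset_closedBall c
  obtain ⟨q, hq⟩ := exists_rat_gt (R + 1)
  obtain ⟨z, hz, hzu⟩ := hn.exists_ne u
  have hKc : ∀ x ∈ K, dist x c ≤ R := fun x hx => hR hx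
  refine ⟨(0, q), 1 / 2, by norm_num, 0, z, hz, ?_, dist_pos.2 hzu, fun x hx h => ?_⟩
  · show dist z c < q
    linarith [hKc z hz]
  · have h' : |dist x c - q| ≤ 1 / 2 := h
    linarith [abs_le.1 h', hKc x hx]

/-- By the perfect set theorem `M` contains an injective image of the Cantor space. -/
theorem continuum_le_mk_of_isClosed {X : Type} [TopologicalSpace X] [PolishSpace X] {M : Set X}
    (hM : IsClosed M) (hc : ¬ M.Countable) : Cardinal.continuum ≤ Cardinal.mk M := by
  obtain ⟨f, hf, -, hinj⟩ := hM.exists_nat_bool_injection_of_not_countable hc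
  have := Cardinal.mk_le_of_injective
    (f := fun x : ℕ → Bool => (⟨f x, hf (mem_range_self x)⟩ : M))
    fun x y hxy => hinj (congrArg Subtype.val hxy)
  simpa using this

theorem mk_plane : Cardinal.mk Plane = Cardinal.continuum := by
  have : Cardinal.mk Plane = Cardinal.mk (Fin 2 → ℝ) :=
    Cardinal.mk_congr (EuclideanSpace.equiv (Fin 2) ℝ).toEquiv
  rw [this]
  rw [Cardinal.mk_arrow, Cardinal.mk_fin, Cardinal.mk_real, Cardinal.lift_continuum,
    Cardinal.lift_natCast]
  exact Cardinal.power_nat_eq Cardinal.aleph0_le_continuum one_le_two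

theorem seesItselfVia_of_mem_criticalSet {C : Set Plane} {u z : Plane}
    (hz : z ∈ criticalSet C u) (hu : u ∉ C)
    (hC : ∀ n m, IsInnerNormal C z n → IsInnerNormal C z m → n = m) : SeesItselfVia C u z := by
  have hne : u - z ≠ 0 := sub_ne_zero.2 fun h => hu (h ▸ hz.1)
  have hn : IsInnerNormal C z (‖u - z‖⁻¹ • (u - z)) := by
    refine ⟨norm_smul_inv_norm (𝕜 := ℝ) hne, fun c hc => ?_⟩
    rw [real_inner_smul_left]
    exact mul_nonneg (by positivity) (hz.2 c hc)
  refine ⟨hz.1, _, hn, fun m hm => hC _ _ hm hn, ‖u - z‖, norm_nonneg _, ?_⟩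
  rw [smul_inv_smul₀ (norm_ne_zero_iff.2 hne), add_sub_cancel]

end Curves

/-! ### The main theorem -/

section Main

/-- For most closed convex curves, most points of the plane see continuum many images of
themselves. -/
theorem eventually_mk_seesItselfVia_eq_continuum :
    ∀ᶠ C : ConvexCurve in residual ConvexCurve, ∀ᶠ u : Plane in residual Plane,
      Cardinal.mk {z : Plane // SeesItselfVia (C.1 : Set Plane) u z} = Cardinal.continuum := by
  filter_upwards [eventually_unique_normal, eventually_peak_imp_splits] with C hC hsplit
  obtain ⟨hK, hKc, hKi, hCK⟩ := body_spec C
  have hu : ∀ᶠ u in residual Plane, u ∉ (C.1 : Set Plane) := by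
    refine residual_of_dense_open C.1.isCompact.isClosed.isOpen_compl ?_
    refine interior_eq_empty_iff_dense_compl.1 ?_
    rw [hCK]
    exact interior_frontier hK.isClosed
  have hs : ∀ᶠ u in residual Plane, ∀ b, Peak (body C) u b → Splits (body C) u b := by
    refine eventually_countable_forall.2 fun b => ?_
    refine eventually_residual_imp (G := {u | Peak (body C) u b})
      (S := {u | Splits (body C) u b}) (Metric.isOpen_iff.2 fun u hu => ?_)
      fun u hu => Metric.mem_closure_iff.2 fun η hη => ?_
    · obtain ⟨δ, hδ, H⟩ := Splits.stable hu
      refine ⟨δ, hδ, fun u' hu' => H _ _ (self_subset_thickening hδ _)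
        (self_subset_thickening hδ _) ?_⟩
      rwa [dist_comm]
    -- A peak for `u` is also one for a nearby point of the dense sequence, where it splits.
    · obtain ⟨δ, hδ, H⟩ := HasPeakIn.stable hu
      obtain ⟨k, hk⟩ := (denseRange_denseSeq Plane).exists_dist_lt u
        (show 0 < min δ η by positivity)
      exact ⟨_, hsplit b k (H _ _ (self_subset_thickening hδ _) (self_subset_thickening hδ _)
        (hk.trans_le (min_le_left _ _))), hk.trans_le (min_le_right _ _)⟩
  filter_upwards [hu, hs] with u hu hs
  refine le_antisymm ((Cardinal.mk_subtype_le _).trans mk_plane.le) ?_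
  have hclosed := isClosed_criticalSet C.1.isCompact.isClosed u
  have hcount : ¬ (criticalSet (C.1 : Set Plane) u).Countable := by
    refine not_countable_of_splitting
      (C.1.isCompact.of_isClosed_subset hclosed fun z hz => hz.1) hclosed
      (B := indexedBall (X := Plane)) (fun b => isClosed_closedBall) (P := Peak (body C) u)
      (fun b hb => ?_) (exists_peak hK (nontrivial_body C) u) hs
    rw [hCK]
    exact HasPeakIn.exists_critical hK hKc hb
  refine (continuum_le_mk_of_isClosed hclosed hcount).trans ?_
  exact Cardinal.mk_subtype_mono fun z hz =>
    seesItselfVia_of_mem_criticalSet hz hu (hC z hz.1)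

end Main

end MagicMirror

/-- For most closed convex curves, most points of the plane see continuum many images of
themselves; `most` refers to the elements of a comeagre set (the filter `residual`). -/
theorem theorem1p1 :
    ∀ᶠ C : MagicMirror.ConvexCurve in residual MagicMirror.ConvexCurve,
      ∀ᶠ u : MagicMirror.Plane in residual MagicMirror.Plane,
        Cardinal.mk {z : MagicMirror.Plane //
            MagicMirror.SeesItselfVia ((C : TopologicalSpace.NonemptyCompacts MagicMirror.Plane) :
              Set MagicMirror.Plane) u z} = Cardinal.continuum :=
  MagicMirror.eventually_mk_seesItselfVia_eq_continuum
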